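/- **Definitions.** A (binary-input, finite-dimensional) cq channel $W$ is a pair of density matrices $\sigma_0,\sigma_1$ on a finite-dimensional complex Hilbert space $B$; it is identified with the cq state $\rho^{XB}=\frac12|0\rangle\langle0|\otimes\sigma_0+\frac12|1\rangle\langle1|\otimes\sigma_1$. For a state $\rho_{AB}$ and $\alpha>0$, $\alpha\ne1$, let $$\widetilde H^\downarrow_\alpha(A|B)_\rho=\frac1{1-\alpha}\log\operatorname{Tr}\Big(\rho_B^{\frac{1-\alpha}{2\alpha}}\rho_{AB}\,\rho_B^{\frac{1-\alpha}{2\alpha}}\Big)^\alpha ,$$ where $\rho_B$ acts as $1_A\otimes\rho_B$, negative powers are taken on the support and $\log$ is the natural logarithm; for $\alpha=1$ let $\widetilde H^\downarrow_1(A|B)_\rho=S(\rho_{AB})-S(\rho_B)$ with $S(\rho)=-\operatorname{Tr}\rho\log\rho$. Write $\widetilde H^\downarrow_\alpha(W)=\widetilde H^\downarrow_\alpha(X|B)_\rho$. For channels $W_1=(\sigma^{(1)}_0,\sigma^{(1)}_1)$ and $W_2=(\sigma^{(2)}_0,\sigma^{(2)}_1)$ with outputs $B_1,B_2$, the channel $W_1\boxplus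 W_2$ is the one from $X_1+X_2$ (mod 2) to $B_1B_2$ with $X_1,X_2$ independent and uniform: on input $u$ it outputs $\frac12\sum_{x\in\{0,1\}}\sigma^{(1)}_{u+x}\otimes\sigma^{(2)}_x$. A function $f:\mathbb R^2\to\mathbb R$ is a valid lower (upper) bound if $f(\widetilde H^\downarrow_\alpha(W_1),\widetilde H^\downarrow_\alpha(W_2))\le\widetilde H^\downarrow_\alpha(W_1\boxplus W_2)$ (respectively $\ge$) for all cq channels $W_1,W_2$. It is the optimal lower (upper) bound if moreover, at every pair $(\widetilde H^\downarrow_\alpha(W_1),\widetilde H^\downarrow_\alpha(W_2))$, it is at least (at most) the value of every other valid lower (upper) bound. **Lemma (Symmetry).** Let $\alpha>0$. (a) For all cq channels $W_1,W_2$ there exist cq channels $\bar W_1,\bar W_2$ with $\widetilde H^\downarrow_\alpha(\bar W_i)=\log 2-\widetilde H^\downarrow_\alpha(W_i)$ for $i=1,2$ such that $$\widetilde H^\downarrow_\alpha(W_1\boxplus W_2)-\tfrac12\big(\widetilde H^\downarrow_\alpha(W_1)+\widetilde H^\downarrow_\alpha(W_2)\big)=\widetilde H^\downarrow_\alpha(\bar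 W_1\boxplus\bar W_2)-\tfrac12\big(\widetilde H^\downarrow_\alpha(\bar W_1)+\widetilde H^\downarrow_\alpha(\bar W_2)\big).$$ (b) Consequently optimal bounds are symmetric: if $F$ is the optimal lower bound or the optimal upper bound, then for all cq channels $W_1,W_2$, with $h_i=\widetilde H^\downarrow_\alpha(W_i)$, $$F(h_1,h_2)-\tfrac12(h_1+h_2)=F(\log2-h_1,\log2-h_2)-\tfrac12\big((\log2-h_1)+(\log2-h_2)\big).$$ -/

import Mathlib

open scoped Kronecker ComplexOrder

noncomputable section

namespace RenyiCombining

/-! ### Matrix powers, partial traces and conditional entropies -/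

/-- Real power of a (positive semidefinite) matrix through its spectral decomposition:
every eigenvalue `t` is replaced by `t ^ s`. For `s ≠ 0` one has `0 ^ s = 0`, so that negative powers
are taken on the support. -/
def matPow {n : Type*} [Fintype n] [DecidableEq n] (M : Matrix n n ℂ) (s : ℝ) : Matrix n n ℂ :=
  cfc (fun t : ℝ => t ^ s) M

/-- The partial trace over the first tensor factor. -/
def ptraceLeft {A B : Type*} [Fintype A] (M : Matrix (A × B) (A × B) ℂ) : Matrix B B ℂ :=
  Matrix.of fun b b' => ∑ a, M (a, b) (a, b')

/-- The von Neumann entropy `- Tr ρ log ρ` (natural logarithm). -/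
def vonNeumann {n : Type*} [Fintype n] [DecidableEq n] (M : Matrix n n ℂ) : ℝ :=
  (cfc Real.negMulLog M).trace.re

/-- The sandwiched conditional Rényi entropy of a bipartite state,
`(1 / (1 - α)) * log Tr (ρ_B ^ ((1-α)/(2α)) ρ_AB ρ_B ^ ((1-α)/(2α))) ^ α`, where `ρ_B` acts as
`1 ⊗ ρ_B`; at `α = 1`, the von Neumann conditional entropy `S(ρ_AB) - S(ρ_B)`. -/
def sandwichedDown {A B : Type*} [Fintype A] [DecidableEq A] [Fintype B] [DecidableEq B]
    (α : ℝ) (ρ : Matrix (A × B) (A × B) ℂ) : ℝ :=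
  if α = 1 then
    vonNeumann ρ - vonNeumann (ptraceLeft ρ)
  else
    let R : Matrix (A × B) (A × B) ℂ :=
      (1 : Matrix A A ℂ) ⊗ₖ matPow (ptraceLeft ρ) ((1 - α) / (2 * α))
    (1 / (1 - α)) * Real.log (matPow (R * ρ * R) α).trace.re

/-! ### Binary-input classical-quantum channels -/

/-- The cq state `½ |0⟩⟨0| ⊗ σ_0 + ½ |1⟩⟨1| ⊗ σ_1`. -/
def cqMatrix {B : Type*} (σ : ZMod 2 → Matrix B B ℂ) : Matrix (ZMod 2 × B) (ZMod 2 × B) ℂ :=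
  ∑ x : ZMod 2, (1 / 2 : ℂ) • (Matrix.single x x (1 : ℂ) ⊗ₖ σ x)

/-- A binary-input cq channel with finite-dimensional output: two density matrices `σ_0`, `σ_1`
on the space with orthonormal basis `Out`. -/
structure CQChannel where
  Out : Type
  [fintypeOut : Fintype Out]
  [decidableEqOut : DecidableEq Out]
  state : ZMod 2 → Matrix Out Out ℂ
  posSemidef_state : ∀ x, (state x).PosSemidef
  trace_state : ∀ x, (state x).trace = 1

attribute [instance] CQChannel.fintypeOut CQChannel.decidableEqOut

namespace CQChannel

/-- The cq state of a channel with uniformly distributed input. -/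
def cqState (W : CQChannel) : Matrix (ZMod 2 × W.Out) (ZMod 2 × W.Out) ℂ :=
  cqMatrix W.state

/-- The entropy of a channel: the sandwiched conditional Rényi entropy of its input given
its output, evaluated on the cq state with uniform input. -/
def H (α : ℝ) (W : CQChannel) : ℝ := sandwichedDown α W.cqState

/-- The joint state of `(X₂, (X₁ + X₂, B₁ B₂))` after the CNOT:
`∑_{x₁, x₂} ¼ |x₂⟩⟨x₂| ⊗ |x₁ + x₂⟩⟨x₁ + x₂| ⊗ σ_{x₁} ⊗ σ_{x₂}`. -/
def combined (W₁ W₂ : CQChannel) :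
    Matrix (ZMod 2 × (ZMod 2 × (W₁.Out × W₂.Out))) (ZMod 2 × (ZMod 2 × (W₁.Out × W₂.Out))) ℂ :=
  ∑ x₁ : ZMod 2, ∑ x₂ : ZMod 2, (1 / 4 : ℂ) •
    (Matrix.single x₂ x₂ (1 : ℂ) ⊗ₖ
      (Matrix.single (x₁ + x₂) (x₁ + x₂) (1 : ℂ) ⊗ₖ (W₁.state x₁ ⊗ₖ W₂.state x₂)))

/-- The combined (check-node) channel: its input is `u = X₁ + X₂`, its output is `B₁ B₂`, and
given `u` the output state is `½ ∑_x σ_{u + x} ⊗ σ_x`. -/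
def boxPlus (W₁ W₂ : CQChannel) : CQChannel where
  Out := W₁.Out × W₂.Out
  state u := (1 / 2 : ℂ) • ∑ x : ZMod 2, W₁.state (u + x) ⊗ₖ W₂.state x
  posSemidef_state u :=
    Matrix.PosSemidef.smul (Matrix.posSemidef_sum _ fun x _ =>
      (W₁.posSemidef_state _).kronecker (W₂.posSemidef_state _))
      (by rw [Complex.le_def]; norm_num : (0 : ℂ) ≤ 1 / 2)
  trace_state u := by
    simp [Matrix.trace_smul, Matrix.trace_sum, Matrix.trace_kronecker, trace_state]

/-- The cq state of the combined channel is the marginal of the CNOT state on `(X₁ + X₂, B₁ B₂)`. -/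
theorem cqState_boxPlus (W₁ W₂ : CQChannel) :
    (boxPlus W₁ W₂).cqState = ptraceLeft (combined W₁ W₂) := by
  change cqMatrix (fun u => (1 / 2 : ℂ) • ∑ x : ZMod 2, W₁.state (u + x) ⊗ₖ W₂.state x) = _
  have key {M : Type} [AddCommMonoid M] (f : ZMod 2 → M) : ∑ x, f x = f 0 + f 1 :=
    Fin.sum_univ_two f
  have h11 : (1 : ZMod 2) + 1 = 0 := by decide
  have h01 : Matrix.single (0 : ZMod 2) (0 : ZMod 2) (1 : ℂ) 1 1 = 0 := by simp
  have h10 : Matrix.single (1 : ZMod 2) (1 : ZMod 2) (1 : ℂ) 0 0 = 0 := by simp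
  ext ⟨u, b⟩ ⟨v, c⟩
  simp only [cqMatrix, ptraceLeft, combined, key, Matrix.of_apply, Matrix.add_apply,
    Matrix.smul_apply, Matrix.kroneckerMap_apply, smul_eq_mul, h11, zero_add, add_zero,
    Matrix.single_apply_same, h01, h10]
  ring

end CQChannel

/-! ### Information combining bounds -/

open CQChannel

/-- `f` is a valid lower bound on the entropy of the combined channel in terms of
the entropies of the two channels. -/
def IsLowerBound (α : ℝ) (f : ℝ → ℝ → ℝ) : Prop :=
  ∀ W₁ W₂ : CQChannel, f (H α W₁) (H α W₂) ≤ H α (boxPlus W₁ W₂)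

/-- `f` is a valid upper bound on the entropy of the combined channel in terms of
the entropies of the two channels. -/
def IsUpperBound (α : ℝ) (f : ℝ → ℝ → ℝ) : Prop :=
  ∀ W₁ W₂ : CQChannel, H α (boxPlus W₁ W₂) ≤ f (H α W₁) (H α W₂)

/-- `L` is the optimal lower bound: at each pair of entropies attained by channels, it is the largest
among all valid lower bounds. -/
def IsOptimalLowerBound (α : ℝ) (L : ℝ → ℝ → ℝ) : Prop :=
  IsLowerBound α L ∧ ∀ f, IsLowerBound α f →
    ∀ W₁ W₂ : CQChannel, f (H α W₁) (H α W₂) ≤ L (H α W₁) (H α W₂)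

/-- `U` is the optimal upper bound: at each pair of entropies attained by channels, it is the smallest
among all valid upper bounds. -/
def IsOptimalUpperBound (α : ℝ) (U : ℝ → ℝ → ℝ) : Prop :=
  IsUpperBound α U ∧ ∀ f, IsUpperBound α f →
    ∀ W₁ W₂ : CQChannel, U (H α W₁) (H α W₂) ≤ f (H α W₁) (H α W₂)

/-- The symmetry of a bound `F` under `h_i ↦ log 2 - h_i`, at all pairs of entropies `h_1`, `h_2`
attained by channels: the excess `F h_1 h_2 - (h_1 + h_2) / 2` is unchanged. -/
def IsSymmetricBound (α : ℝ) (F : ℝ → ℝ → ℝ) : Prop :=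
  ∀ W₁ W₂ : CQChannel,
    F (H α W₁) (H α W₂) - (1 / 2) * (H α W₁ + H α W₂) =
      F (Real.log 2 - H α W₁) (Real.log 2 - H α W₂)
        - (1 / 2) * ((Real.log 2 - H α W₁) + (Real.log 2 - H α W₂))

end RenyiCombining

end

/-!
The symmetry comes from a dual channel. For a channel `W` with average output `ρ` put
`Q_x = ρ ^ s (½ σ_x) ρ ^ s`, `s = (1 - α) / (2 α)` (`sandwich`), and `Q = Q_0 ⊕ Q_1`. Up to the factor
`1 / (1 - α)` the entropy is `log Tr Q ^ α`, while `Q_0 + Q_1 = ρ ^ (1 / α)` (`sum_sandwich`). Let `X`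
be the flip of the two summands. The dual channel (`dual`) sends `x` to
`Q ^ (α / 2) (1 + (-1) ^ x X) Q ^ (α / 2) / Tr Q ^ α`.

Its average output is `Q ^ α / Tr Q ^ α`, so that its own sandwiched outputs are multiples of
`Q ^ ½ (1 ± X) Q ^ ½`. As `1 ± X = J Jᴴ` with `J` a multiple of an isometry, and `A Aᴴ` and `Aᴴ A` have
the same nonzero spectrum (`trace_cfc_mul_conjTranspose_comm`), this has the nonzero spectrum of
`Jᴴ Q J = Q_0 + Q_1 = ρ ^ (1 / α)`, which gives `H (dual W) = log 2 - H W` (`H_dual`). For two dual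
channels the matrix in the middle is `1 ± X ⊗ X`, whose image splits by the parity of the two labels;
compressing `Q₁ ⊗ Q₂` to it yields the direct sum of the sandwiched outputs of `W₁ ⊞ W₂`
(`trace_cfc_sandwich_boxPlus_dual`). Hence
`H (dual W₁ ⊞ dual W₂) = log 2 + H (W₁ ⊞ W₂) - H W₁ - H W₂` (`H_boxPlus_dual`). For `α = 1` the same
argument applies with `-t log t` in place of `t ^ α`.

These two identities say that the reflection of a valid bound is a valid bound. An optimal bound is
therefore comparable with its reflection at every attained pair and at its mirror image, and the two
inequalities together give equality.
-/

noncomputable section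

namespace RenyiCombining

open Polynomial Matrix

/-! ### Functional calculus of Hermitian matrices -/

section FunctionalCalculus

variable {m n : Type*} [Fintype m] [DecidableEq m] [Fintype n] [DecidableEq n]

theorem exists_polynomial_eval_eq (f : ℝ → ℝ) {S : Set ℝ} (hS : S.Finite) :
    ∃ p : ℝ[X], ∀ t ∈ S, p.eval t = f t :=
  ⟨Lagrange.interpolate hS.toFinset id f, fun t ht => by
    simpa using Lagrange.eval_interpolate_at_node f (Set.injOn_id _) (hS.mem_toFinset.2 ht)⟩

theorem cfc_eq_aeval {M : Matrix n n ℂ} (hM : M.IsHermitian) {f : ℝ → ℝ} {p : ℝ[X]}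
    (h : ∀ t ∈ spectrum ℝ M, p.eval t = f t) : cfc f M = aeval M p := by
  rw [← cfc_polynomial p M hM]
  exact cfc_congr fun t ht => (h t ht).symm

theorem aeval_conj_diagonal {U : Matrix n n ℂ} (hU : Uᴴ * U = 1) (d : n → ℝ) (p : ℝ[X]) :
    aeval (U * diagonal (fun i => (d i : ℂ)) * Uᴴ) p =
      U * diagonal (fun i => ((p.eval (d i) : ℝ) : ℂ)) * Uᴴ := by
  have hU' : U * Uᴴ = 1 := mul_eq_one_comm.1 hU
  induction p using Polynomial.induction_on' with
  | add p q hp hq =>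
    rw [map_add, hp, hq, ← add_mul, ← mul_add, diagonal_add]
    simp
  | monomial k c =>
    have hpow : (U * diagonal (fun i => (d i : ℂ)) * Uᴴ) ^ k =
        U * diagonal (fun i => (d i : ℂ) ^ k) * Uᴴ := by
      induction k with
      | zero => simp [hU']
      | succ k ih =>
        rw [pow_succ, ih]
        calc _ = U * diagonal (fun i => (d i : ℂ) ^ k) * (Uᴴ * U) *
              diagonal (fun i => (d i : ℂ)) * Uᴴ := by simp only [mul_assoc]
          _ = _ := by
              rw [hU, mul_one, mul_assoc U, diagonal_mul_diagonal]
              simp [pow_succ]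
    rw [aeval_monomial, hpow, ← Algebra.smul_def, ← smul_mul_assoc, ← mul_smul_comm,
      ← diagonal_smul]
    congr 3
    ext i
    simp

theorem cfc_conj_diagonal {U : Matrix n n ℂ} (hU : Uᴴ * U = 1) (d : n → ℝ) (f : ℝ → ℝ) :
    cfc f (U * diagonal (fun i => (d i : ℂ)) * Uᴴ) =
      U * diagonal (fun i => (f (d i) : ℂ)) * Uᴴ := by
  have hM : (U * diagonal (fun i => (d i : ℂ)) * Uᴴ).IsHermitian :=
    isHermitian_mul_mul_conjTranspose _ (isHermitian_diagonal_of_self_adjoint _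
      (by ext i; simp))
  obtain ⟨p, hp⟩ := exists_polynomial_eval_eq f
    ((finite_real_spectrum (A := U * diagonal (fun i => (d i : ℂ)) * Uᴴ)).union
      (Set.finite_range d))
  rw [cfc_eq_aeval hM fun t ht => hp t (Or.inl ht), aeval_conj_diagonal hU]
  simp only [hp _ (Or.inr (Set.mem_range_self _))]

theorem exists_eq_conj_diagonal {M : Matrix n n ℂ} (hM : M.PosSemidef) :
    ∃ (U : Matrix n n ℂ) (d : n → ℝ), Uᴴ * U = 1 ∧ (∀ i, 0 ≤ d i) ∧
      M = U * diagonal (fun i => (d i : ℂ)) * Uᴴ := by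
  refine ⟨hM.1.eigenvectorUnitary, hM.1.eigenvalues, ?_, hM.eigenvalues_nonneg, ?_⟩
  · exact Unitary.coe_star_mul_self hM.1.eigenvectorUnitary
  · exact hM.1.spectral_theorem

theorem trace_conj_diagonal {U : Matrix n n ℂ} (hU : Uᴴ * U = 1) (d : n → ℝ) :
    (U * diagonal (fun i => (d i : ℂ)) * Uᴴ).trace = ((∑ i, d i : ℝ) : ℂ) := by
  rw [trace_mul_comm, ← mul_assoc, hU, one_mul, trace_diagonal]
  simp

theorem kronecker_conj_diagonal (U : Matrix m m ℂ) (V : Matrix n n ℂ) (d : m → ℝ) (e : n → ℝ) :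
    (U * diagonal (fun i => (d i : ℂ)) * Uᴴ) ⊗ₖ (V * diagonal (fun i => (e i : ℂ)) * Vᴴ) =
      (U ⊗ₖ V) * diagonal (fun i => ((d i.1 * e i.2 : ℝ) : ℂ)) * (U ⊗ₖ V)ᴴ := by
  rw [mul_kronecker_mul, mul_kronecker_mul, diagonal_kronecker_diagonal, conjTranspose_kronecker]
  simp

theorem conjTranspose_kronecker_mul_self {U : Matrix m m ℂ} {V : Matrix n n ℂ}
    (hU : Uᴴ * U = 1) (hV : Vᴴ * V = 1) : (U ⊗ₖ V)ᴴ * (U ⊗ₖ V) = 1 := by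
  rw [conjTranspose_kronecker, ← mul_kronecker_mul, hU, hV, one_kronecker_one]

/-- The nonzero spectra of `A * Aᴴ` and `Aᴴ * A` agree with multiplicities, so a function vanishing
at `0` has the same trace on both. -/
theorem trace_cfc_mul_conjTranspose_comm {f : ℝ → ℝ} (hf : f 0 = 0) (A : Matrix m n ℂ) :
    (cfc f (A * Aᴴ)).trace = (cfc f (Aᴴ * A)).trace := by
  obtain ⟨p, hp⟩ := exists_polynomial_eval_eq f
    (((finite_real_spectrum (A := A * Aᴴ)).union (finite_real_spectrum (A := Aᴴ * A))).union
      (Set.finite_singleton 0))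
  have hp0 : p.coeff 0 = 0 := by
    rw [coeff_zero_eq_eval_zero, hp 0 (Or.inr rfl), hf]
  rw [cfc_eq_aeval (isHermitian_mul_conjTranspose_self A) fun t ht => hp t (Or.inl (Or.inl ht)),
    cfc_eq_aeval (isHermitian_conjTranspose_mul_self A) fun t ht => hp t (Or.inl (Or.inr ht)),
    aeval_eq_sum_range, aeval_eq_sum_range, trace_sum, trace_sum]
  refine Finset.sum_congr rfl fun k _ => ?_
  rcases k with _ | k
  · simp [hp0]
  · have hpow : ∀ j : ℕ, (A * Aᴴ) ^ j * A = A * (Aᴴ * A) ^ j := by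
      intro j
      induction j with
      | zero => simp
      | succ j ih =>
        rw [pow_succ', Matrix.mul_assoc, ih, pow_succ']
        simp only [Matrix.mul_assoc]
    rw [trace_smul, trace_smul, pow_succ, ← Matrix.mul_assoc, hpow, Matrix.mul_assoc,
      trace_mul_comm, Matrix.mul_assoc, ← pow_succ]

theorem trace_cfc_smul_mul_conjTranspose_comm {f : ℝ → ℝ} (hf : f 0 = 0) {c : ℝ} (hc : 0 ≤ c)
    (A : Matrix m n ℂ) :
    (cfc f (c • (A * Aᴴ))).trace = (cfc f (c • (Aᴴ * A))).trace := by
  have h := trace_cfc_mul_conjTranspose_comm hf (√c • A)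
  simpa only [conjTranspose_smul, star_trivial, Matrix.smul_mul, Matrix.mul_smul, smul_smul,
    Real.mul_self_sqrt hc] using h

end FunctionalCalculus

/-! ### Powers of positive semidefinite matrices -/

section MatPow

variable {m n : Type*} [Fintype m] [DecidableEq m] [Fintype n] [DecidableEq n]
  {A : Matrix m m ℂ} {B : Matrix n n ℂ}

theorem matPow_conj_diagonal {U : Matrix n n ℂ} (hU : Uᴴ * U = 1) (d : n → ℝ) (s : ℝ) :
    matPow (U * diagonal (fun i => (d i : ℂ)) * Uᴴ) s =
      U * diagonal (fun i => ((d i ^ s : ℝ) : ℂ)) * Uᴴ :=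
  cfc_conj_diagonal hU d _

theorem posSemidef_matPow (hB : B.PosSemidef) (s : ℝ) : (matPow B s).PosSemidef := by
  obtain ⟨U, d, hU, hd, rfl⟩ := exists_eq_conj_diagonal hB
  rw [matPow_conj_diagonal hU]
  refine PosSemidef.mul_mul_conjTranspose_same (PosSemidef.diagonal fun i => ?_) _
  simpa using Real.rpow_nonneg (hd i) s

theorem matPow_kronecker (hA : A.PosSemidef) (hB : B.PosSemidef) (s : ℝ) :
    matPow (A ⊗ₖ B) s = matPow A s ⊗ₖ matPow B s := by
  obtain ⟨U, d, hU, hd, rfl⟩ := exists_eq_conj_diagonal hA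
  obtain ⟨V, e, hV, he, rfl⟩ := exists_eq_conj_diagonal hB
  rw [kronecker_conj_diagonal, matPow_conj_diagonal (conjTranspose_kronecker_mul_self hU hV),
    matPow_conj_diagonal hU, matPow_conj_diagonal hV, kronecker_conj_diagonal]
  simp only [Real.mul_rpow (hd _) (he _)]

theorem smul_conj_diagonal (U : Matrix n n ℂ) (d : n → ℝ) (c : ℝ) :
    c • (U * diagonal (fun i => (d i : ℂ)) * Uᴴ) =
      U * diagonal (fun i => ((c * d i : ℝ) : ℂ)) * Uᴴ := by
  rw [← smul_mul_assoc, ← mul_smul_comm, ← diagonal_smul]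
  congr 3
  ext i
  simp

theorem conj_diagonal_mul_conj_diagonal {U : Matrix n n ℂ} (hU : Uᴴ * U = 1) (d e : n → ℝ) :
    (U * diagonal (fun i => (d i : ℂ)) * Uᴴ) * (U * diagonal (fun i => (e i : ℂ)) * Uᴴ) =
      U * diagonal (fun i => ((d i * e i : ℝ) : ℂ)) * Uᴴ := by
  calc _ = U * diagonal (fun i => (d i : ℂ)) * (Uᴴ * U) * diagonal (fun i => (e i : ℂ)) * Uᴴ := by
        simp only [mul_assoc]
    _ = _ := by
        rw [hU, mul_one, mul_assoc U, diagonal_mul_diagonal]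
        simp

theorem matPow_smul (hB : B.PosSemidef) {c : ℝ} (hc : 0 ≤ c) (s : ℝ) :
    matPow (c • B) s = c ^ s • matPow B s := by
  obtain ⟨U, d, hU, hd, rfl⟩ := exists_eq_conj_diagonal hB
  rw [smul_conj_diagonal, matPow_conj_diagonal hU, matPow_conj_diagonal hU, smul_conj_diagonal]
  simp only [Real.mul_rpow hc (hd _)]

/-- On a kernel vector the identity reads `0 = 0` because `s + t ≠ 0`. -/
theorem matPow_mul_matPow (hB : B.PosSemidef) {s t : ℝ} (hst : s + t ≠ 0) :
    matPow B s * matPow B t = matPow B (s + t) := by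
  obtain ⟨U, d, hU, hd, rfl⟩ := exists_eq_conj_diagonal hB
  simp only [matPow_conj_diagonal hU, conj_diagonal_mul_conj_diagonal hU,
    Real.rpow_add' (hd _) hst]

theorem matPow_matPow (hB : B.PosSemidef) (s t : ℝ) :
    matPow (matPow B s) t = matPow B (s * t) := by
  obtain ⟨U, d, hU, hd, rfl⟩ := exists_eq_conj_diagonal hB
  simp only [matPow_conj_diagonal hU, Real.rpow_mul (hd _)]

theorem matPow_one (hB : B.PosSemidef) : matPow B 1 = B := by
  obtain ⟨U, d, hU, hd, rfl⟩ := exists_eq_conj_diagonal hB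
  simp only [matPow_conj_diagonal hU, Real.rpow_one]

theorem matPow_zero (hB : B.PosSemidef) : matPow B 0 = 1 := by
  obtain ⟨U, d, hU, hd, rfl⟩ := exists_eq_conj_diagonal hB
  simp [matPow_conj_diagonal hU, mul_eq_one_comm.1 hU]

theorem trace_eq_ofReal_re (hB : B.PosSemidef) : B.trace = (B.trace.re : ℂ) := by
  obtain ⟨U, d, hU, hd, rfl⟩ := exists_eq_conj_diagonal hB
  rw [trace_conj_diagonal hU, Complex.ofReal_re]

theorem vonNeumann_smul (hB : B.PosSemidef) (c : ℝ) :
    vonNeumann (c • B) = c * vonNeumann B + Real.negMulLog c * B.trace.re := by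
  obtain ⟨U, d, hU, hd, rfl⟩ := exists_eq_conj_diagonal hB
  rw [vonNeumann, vonNeumann, smul_conj_diagonal, cfc_conj_diagonal hU, cfc_conj_diagonal hU,
    trace_conj_diagonal hU, trace_conj_diagonal hU, trace_conj_diagonal hU]
  simp only [Complex.ofReal_re, Real.negMulLog_mul, Finset.sum_add_distrib, Finset.mul_sum]
  rw [add_comm]
  congr 1
  exact Finset.sum_congr rfl fun i _ => mul_comm _ _

theorem vonNeumann_kronecker (hA : A.PosSemidef) (hB : B.PosSemidef) :
    vonNeumann (A ⊗ₖ B) = A.trace.re * vonNeumann B + B.trace.re * vonNeumann A := by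
  obtain ⟨U, d, hU, hd, rfl⟩ := exists_eq_conj_diagonal hA
  obtain ⟨V, e, hV, he, rfl⟩ := exists_eq_conj_diagonal hB
  simp only [vonNeumann]
  rw [kronecker_conj_diagonal, cfc_conj_diagonal (conjTranspose_kronecker_mul_self hU hV),
    cfc_conj_diagonal hU, cfc_conj_diagonal hV,
    trace_conj_diagonal (conjTranspose_kronecker_mul_self hU hV),
    trace_conj_diagonal hU, trace_conj_diagonal hV, trace_conj_diagonal hU, trace_conj_diagonal hV]
  simp only [Complex.ofReal_re, Real.negMulLog_mul, Finset.sum_add_distrib, Fintype.sum_prod_type,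
    Finset.sum_mul_sum]
  rw [add_comm]
  congr 1
  rw [Finset.sum_comm]

end MatPow

/-! ### Direct sums of matrices -/

section DirectSum

variable {o n : Type*} [DecidableEq o]

/-- The direct sum `∑ x, |x⟩⟨x| ⊗ M x`, with the label of the summand as the first index. -/
def directSum (M : o → Matrix n n ℂ) : Matrix (o × n) (o × n) ℂ :=
  Matrix.of fun p q => if p.1 = q.1 then M p.1 p.2 q.2 else 0

theorem directSum_apply (M : o → Matrix n n ℂ) (p q : o × n) :
    directSum M p q = if p.1 = q.1 then M p.1 p.2 q.2 else 0 := rfl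

theorem directSum_mul [Fintype o] [Fintype n] (M N : o → Matrix n n ℂ) :
    directSum M * directSum N = directSum fun x => M x * N x := by
  ext ⟨x, a⟩ ⟨y, b⟩
  simp only [mul_apply, directSum_apply, Fintype.sum_prod_type, ite_mul, zero_mul, mul_ite,
    mul_zero]
  by_cases h : x = y <;> simp [h, Finset.sum_ite_irrel]

theorem directSum_one [DecidableEq n] : directSum (fun _ : o => (1 : Matrix n n ℂ)) = 1 := by
  ext ⟨x, a⟩ ⟨y, b⟩
  simp only [directSum_apply, one_apply, Prod.mk.injEq]
  split_ifs <;> tauto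

theorem trace_directSum [Fintype o] [Fintype n] (M : o → Matrix n n ℂ) :
    (directSum M).trace = ∑ x, (M x).trace := by
  simp [trace, directSum_apply, Fintype.sum_prod_type]

theorem isHermitian_directSum {M : o → Matrix n n ℂ} (hM : ∀ x, (M x).IsHermitian) :
    (directSum M).IsHermitian := by
  ext ⟨x, a⟩ ⟨y, b⟩
  simp only [conjTranspose_apply, directSum_apply]
  by_cases h : x = y
  · subst h
    simpa using (hM x).apply a b
  · simp [h, Ne.symm h]

variable [Fintype o] [Fintype n] [DecidableEq n]

theorem aeval_directSum (M : o → Matrix n n ℂ) (p : ℝ[X]) :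
    aeval (directSum M) p = directSum fun x => aeval (M x) p := by
  induction p using Polynomial.induction_on' with
  | add p q hp hq =>
    ext i j
    simp only [map_add, hp, hq, Matrix.add_apply, directSum_apply]
    split_ifs <;> simp
  | monomial k c =>
    have hpow : directSum M ^ k = directSum fun x => M x ^ k := by
      induction k with
      | zero => simp [directSum_one]
      | succ k ih => simp only [pow_succ, ih, directSum_mul]
    simp only [aeval_monomial, hpow, ← Algebra.smul_def]
    ext i j
    simp [directSum_apply]

theorem cfc_directSum (f : ℝ → ℝ) {M : o → Matrix n n ℂ} (hM : ∀ x, (M x).IsHermitian) :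
    cfc f (directSum M) = directSum fun x => cfc f (M x) := by
  obtain ⟨p, hp⟩ := exists_polynomial_eval_eq f
    ((finite_real_spectrum (A := directSum M)).union
      (Set.finite_iUnion fun x => finite_real_spectrum (A := M x)))
  rw [cfc_eq_aeval (isHermitian_directSum hM) fun t ht => hp t (Or.inl ht), aeval_directSum]
  congr 1
  ext1 x
  rw [cfc_eq_aeval (hM x) fun t ht => hp t (Or.inr (Set.mem_iUnion.2 ⟨x, ht⟩))]

theorem posSemidef_directSum {M : o → Matrix n n ℂ} (hM : ∀ x, (M x).PosSemidef) :
    (directSum M).PosSemidef := by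
  have h : directSum M = (directSum fun x => matPow (M x) (1 / 2)) *
      (directSum fun x => matPow (M x) (1 / 2))ᴴ := by
    rw [(isHermitian_directSum fun x => (posSemidef_matPow (hM x) _).1).eq, directSum_mul]
    congr 1
    ext1 x
    rw [matPow_mul_matPow (hM x) (by norm_num), add_halves, matPow_one (hM x)]
  rw [h]
  exact posSemidef_self_mul_conjTranspose _

end DirectSum

/-! ### The sandwiched states of a channel -/

namespace CQChannel

theorem sum_zmod_two {M : Type*} [AddCommMonoid M] (f : ZMod 2 → M) : ∑ x, f x = f 0 + f 1 :=
  Fin.sum_univ_two f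

/-- The average output state `½ (σ_0 + σ_1)`. -/
def avg (W : CQChannel) : Matrix W.Out W.Out ℂ := (1 / 2 : ℝ) • ∑ x, W.state x

/-- The sandwiched output `ρ ^ s (½ σ_x) ρ ^ s` with `ρ` the average output and
`s = (1 - α) / (2 α)`. -/
def sandwich (α : ℝ) (W : CQChannel) (x : ZMod 2) : Matrix W.Out W.Out ℂ :=
  matPow W.avg ((1 - α) / (2 * α)) * ((1 / 2 : ℝ) • W.state x) *
    matPow W.avg ((1 - α) / (2 * α))

variable (α : ℝ) (W W₁ W₂ : CQChannel)

theorem posSemidef_avg : W.avg.PosSemidef :=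
  (posSemidef_sum _ fun x _ => W.posSemidef_state x).smul (by norm_num : (0 : ℝ) ≤ 1 / 2)

theorem trace_avg : W.avg.trace = 1 := by
  rw [avg, trace_smul, trace_sum]
  simp [trace_state]

theorem posSemidef_half_state (x : ZMod 2) : ((1 / 2 : ℝ) • W.state x).PosSemidef :=
  (W.posSemidef_state x).smul (by norm_num : (0 : ℝ) ≤ 1 / 2)

theorem posSemidef_sandwich (x : ZMod 2) : (sandwich α W x).PosSemidef := by
  have h := (W.posSemidef_half_state x).mul_mul_conjTranspose_same
    (matPow W.avg ((1 - α) / (2 * α)))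
  rwa [(posSemidef_matPow W.posSemidef_avg _).1.eq] at h

theorem cqState_eq_directSum : W.cqState = directSum fun x => (1 / 2 : ℝ) • W.state x := by
  ext ⟨x, a⟩ ⟨y, b⟩
  rw [cqState, cqMatrix, Matrix.sum_apply]
  simp only [Matrix.smul_apply, kroneckerMap_apply, directSum_apply, single_apply]
  by_cases h : x = y
  · subst h
    simp
  · rw [if_neg h]
    refine Finset.sum_eq_zero fun z _ => ?_
    rw [if_neg (fun hz => h (hz.1.symm.trans hz.2))]
    simp

theorem ptraceLeft_cqState : ptraceLeft W.cqState = W.avg := by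
  ext a b
  simp [ptraceLeft, cqState_eq_directSum, directSum_apply, avg, sum_zmod_two]

theorem one_kronecker_eq_directSum {B : Type*} (M : Matrix B B ℂ) :
    (1 : Matrix (ZMod 2) (ZMod 2) ℂ) ⊗ₖ M = directSum fun _ => M := by
  ext ⟨x, a⟩ ⟨y, b⟩
  simp [directSum_apply, one_apply]

/-- The quantity `Tr (ρ_B ^ s ρ_XB ρ_B ^ s) ^ α` inside the logarithm of the entropy. -/
def renyiTrace : ℝ := (matPow (directSum (sandwich α W)) α).trace.re

theorem renyiTrace_eq_sum :
    renyiTrace α W = ∑ x, (matPow (sandwich α W x) α).trace.re := by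
  rw [renyiTrace, matPow, cfc_directSum _ fun x => (posSemidef_sandwich α W x).1, trace_directSum,
    Complex.re_sum]
  rfl

variable {α}

theorem H_of_ne_one (hα : α ≠ 1) : H α W = 1 / (1 - α) * Real.log (renyiTrace α W) := by
  simp only [H, sandwichedDown, if_neg hα]
  rw [ptraceLeft_cqState, one_kronecker_eq_directSum, cqState_eq_directSum, directSum_mul,
    directSum_mul]
  rfl

/-- At `α = 1` the exponent `s` vanishes and `ρ ^ 0 = 1`, also on the kernel of `ρ`. -/
theorem sandwich_one (x : ZMod 2) : sandwich 1 W x = (1 / 2 : ℝ) • W.state x := by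
  simp [sandwich, matPow_zero W.posSemidef_avg]

theorem H_one : H 1 W = vonNeumann (directSum (sandwich 1 W)) - vonNeumann W.avg := by
  rw [H, sandwichedDown, if_pos rfl, ptraceLeft_cqState, cqState_eq_directSum]
  rw [show sandwich 1 W = fun x => (1 / 2 : ℝ) • W.state x from funext W.sandwich_one]

theorem vonNeumann_directSum {o n : Type*} [Fintype o] [DecidableEq o] [Fintype n] [DecidableEq n]
    {M : o → Matrix n n ℂ} (hM : ∀ x, (M x).IsHermitian) :
    vonNeumann (directSum M) = ∑ x, vonNeumann (M x) := by
  rw [vonNeumann, cfc_directSum _ hM, trace_directSum, Complex.re_sum]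
  rfl

theorem sum_sandwich (hα : 0 < α) : ∑ x, sandwich α W x = matPow W.avg (1 / α) := by
  have h : (1 - α) / (2 * α) + 1 + (1 - α) / (2 * α) = 1 / α := by field_simp; ring
  have h' : (1 - α) / (2 * α) + 1 = 1 / (2 * α) + 1 / 2 := by field_simp; ring
  calc ∑ x, sandwich α W x
      = matPow W.avg ((1 - α) / (2 * α)) * W.avg * matPow W.avg ((1 - α) / (2 * α)) := by
        simp only [sandwich]
        rw [← Finset.sum_mul, ← Finset.mul_sum, ← Finset.smul_sum, avg]
    _ = matPow W.avg (1 / α) := by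
        conv_lhs =>
          enter [1, 2]
          rw [← matPow_one W.posSemidef_avg]
        rw [matPow_mul_matPow W.posSemidef_avg (by rw [h']; positivity),
          matPow_mul_matPow W.posSemidef_avg (by rw [h]; positivity), h]

theorem renyiTrace_pos (hα : 0 < α) : 0 < renyiTrace α W := by
  have hQ := posSemidef_directSum (posSemidef_sandwich α W)
  have hQα := posSemidef_matPow hQ α
  have h0 : 0 ≤ renyiTrace α W := (Complex.le_def.1 hQα.trace_nonneg).1
  refine lt_of_le_of_ne h0 fun h => ?_
  -- A vanishing trace kills every `sandwich α W x`, hence their sum, hence the average state.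
  have hz : matPow (directSum (sandwich α W)) α = 0 := by
    rw [← hQα.trace_eq_zero_iff, trace_eq_ofReal_re hQα, ← renyiTrace, ← h, Complex.ofReal_zero]
  have hzero : ∀ {n : Type} [Fintype n] [DecidableEq n] {t : ℝ}, t ≠ 0 →
      matPow (0 : Matrix n n ℂ) t = 0 := by
    intro n _ _ t ht
    simp [matPow, Real.zero_rpow ht]
  have hQ0 : directSum (sandwich α W) = 0 := by
    rw [← matPow_one hQ, ← mul_one_div_cancel hα.ne', ← matPow_matPow hQ, hz,
      hzero (by positivity)]
  have hx : ∀ x, sandwich α W x = 0 := fun x => by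
    ext a b
    simpa [directSum_apply] using congrFun (congrFun hQ0 (x, a)) (x, b)
  have havg : W.avg = 0 := by
    rw [← matPow_one W.posSemidef_avg, ← one_div_mul_cancel hα.ne',
      ← matPow_matPow W.posSemidef_avg, ← sum_sandwich W hα, Finset.sum_eq_zero fun x _ => hx x,
      hzero hα.ne']
  simpa [havg] using W.trace_avg

theorem renyiTrace_one : renyiTrace 1 W = 1 := by
  have hQ := posSemidef_directSum (posSemidef_sandwich 1 W)
  rw [renyiTrace, matPow_one hQ, trace_directSum]
  simp [sandwich_one, trace_smul, trace_state]

/-! ### Combination of channels -/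

theorem avg_boxPlus : (boxPlus W₁ W₂).avg = W₁.avg ⊗ₖ W₂.avg := by
  change ((1 / 2 : ℝ) • ∑ u, (1 / 2 : ℂ) • ∑ x, W₁.state (u + x) ⊗ₖ W₂.state x) = _
  ext ⟨a, b⟩ ⟨c, d⟩
  have h11 : (1 : ZMod 2) + 1 = 0 := by decide
  simp only [avg, sum_zmod_two, Matrix.smul_apply, Matrix.add_apply, kroneckerMap_apply,
    Complex.real_smul, smul_eq_mul, h11, zero_add, add_zero]
  push_cast
  ring

theorem sandwich_boxPlus (u : ZMod 2) :
    sandwich α (boxPlus W₁ W₂) u = ∑ x, sandwich α W₁ (u + x) ⊗ₖ sandwich α W₂ x := by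
  have h : (1 / 2 : ℝ) • (boxPlus W₁ W₂).state u =
      ∑ x, ((1 / 2 : ℝ) • W₁.state (u + x)) ⊗ₖ ((1 / 2 : ℝ) • W₂.state x) := by
    change ((1 / 2 : ℝ) • (1 / 2 : ℂ) • ∑ x, W₁.state (u + x) ⊗ₖ W₂.state x) = _
    ext ⟨a, b⟩ ⟨c, d⟩
    simp only [sum_zmod_two, Matrix.smul_apply, Matrix.add_apply, kroneckerMap_apply,
      Complex.real_smul, smul_eq_mul]
    push_cast
    ring
  -- `(boxPlus W₁ W₂).Out` is unfolded to `W₁.Out × W₂.Out` by quantifying over matrices on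
  -- the latter.
  have key : ∀ ρ M : Matrix (W₁.Out × W₂.Out) (W₁.Out × W₂.Out) ℂ, ρ = W₁.avg ⊗ₖ W₂.avg →
      M = ∑ x, ((1 / 2 : ℝ) • W₁.state (u + x)) ⊗ₖ ((1 / 2 : ℝ) • W₂.state x) →
      matPow ρ ((1 - α) / (2 * α)) * M * matPow ρ ((1 - α) / (2 * α)) =
        ∑ x, sandwich α W₁ (u + x) ⊗ₖ sandwich α W₂ x := by
    rintro _ _ rfl rfl
    rw [matPow_kronecker W₁.posSemidef_avg W₂.posSemidef_avg, Finset.mul_sum, Finset.sum_mul]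
    simp only [← mul_kronecker_mul, sandwich]
  exact key _ _ (avg_boxPlus W₁ W₂) h

/-! ### Sign vectors on a qubit -/

/-- The character `(-1) ^ (x y)` of `ZMod 2`. -/
def sign (x y : ZMod 2) : ℤ := if x = 1 ∧ y = 1 then -1 else 1

/-- The map `|b⟩ ↦ ∑ y, (-1) ^ (x y) |y⟩ |b⟩`, which is `√2` times the isometry onto the `x`-th
eigenspace of the bit flip. -/
def signIncl (B : Type*) [DecidableEq B] (x : ZMod 2) : Matrix (ZMod 2 × B) B ℂ :=
  Matrix.of fun p c => if p.2 = c then (sign x p.1 : ℂ) else 0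

/-- The map `|v⟩ |b₁ b₂⟩ ↦ ∑ y, (-1) ^ (u y) |y⟩ |b₁⟩ |y + v⟩ |b₂⟩`, which is `√2` times the isometry
onto the `u`-th eigenspace of the simultaneous flip of two bits. -/
def pairSignIncl (B₁ B₂ : Type*) [DecidableEq B₁] [DecidableEq B₂] (u : ZMod 2) :
    Matrix ((ZMod 2 × B₁) × (ZMod 2 × B₂)) (ZMod 2 × (B₁ × B₂)) ℂ :=
  Matrix.of fun p q => if p.2.2 = q.2.2 then if p.2.1 = p.1.1 + q.1 then
    if p.1.2 = q.2.1 then (sign u p.1.1 : ℂ) else 0 else 0 else 0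

section Signs

variable {B B₁ B₂ : Type*} [Fintype B] [DecidableEq B] [Fintype B₁] [DecidableEq B₁] [Fintype B₂]
  [DecidableEq B₂]

theorem signIncl_mul_conjTranspose_apply (x : ZMod 2) (p q : ZMod 2 × B) :
    (signIncl B x * (signIncl B x)ᴴ) p q =
      if p.2 = q.2 then ((sign x p.1 * sign x q.1 : ℤ) : ℂ) else 0 := by
  simp only [mul_apply, signIncl, conjTranspose_apply, of_apply, ite_mul, zero_mul,
    Finset.sum_ite_eq, Finset.mem_univ, if_true]
  by_cases h : p.2 = q.2
  · simp [h]
  · simp [h, Ne.symm h]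

theorem sum_signIncl_mul_conjTranspose :
    ∑ x, signIncl B x * (signIncl B x)ᴴ = (2 : ℝ) • (1 : Matrix (ZMod 2 × B) (ZMod 2 × B) ℂ) := by
  have key : ∀ y z : ZMod 2, ∑ x, sign x y * sign x z = if y = z then 2 else 0 := by decide
  ext ⟨y, b⟩ ⟨z, c⟩
  rw [Matrix.sum_apply]
  simp only [signIncl_mul_conjTranspose_apply, Matrix.smul_apply, one_apply, Prod.mk.injEq]
  by_cases h : b = c
  · simp only [h, if_true, and_true, ← Int.cast_sum, key]
    split_ifs <;> simp
  · simp [h]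

theorem conjTranspose_signIncl_mul_directSum_mul (M : ZMod 2 → Matrix B B ℂ) (x : ZMod 2) :
    (signIncl B x)ᴴ * directSum M * signIncl B x = ∑ y, M y := by
  have key : ∀ x y : ZMod 2, sign x y * sign x y = 1 := by decide
  ext b c
  rw [Matrix.sum_apply]
  simp only [mul_apply, signIncl, conjTranspose_apply, of_apply, directSum_apply,
    Fintype.sum_prod_type]
  simp only [apply_ite star, star_zero, ite_mul, zero_mul, Finset.sum_ite_eq',
    Finset.mem_univ, if_true]
  simp only [mul_ite, mul_zero, Finset.sum_ite_eq', Finset.mem_univ, if_true]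
  refine Finset.sum_congr rfl fun y _ => ?_
  have := congrArg (Int.cast (R := ℂ)) (key x y)
  push_cast at this
  simp only [star_intCast]
  linear_combination M y b c * this

/-- Averaging the product of the signs over `x` projects onto equal parity of the two labels. -/
theorem sum_signIncl_kronecker (u : ZMod 2) :
    ∑ x, (signIncl B₁ (u + x) * (signIncl B₁ (u + x))ᴴ) ⊗ₖ (signIncl B₂ x * (signIncl B₂ x)ᴴ) =
      (2 : ℝ) • (pairSignIncl B₁ B₂ u * (pairSignIncl B₁ B₂ u)ᴴ) := by
  have key : ∀ u y₁ y₂ z₁ z₂ : ZMod 2,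
      ∑ x, (sign (u + x) y₁ * sign (u + x) z₁) * (sign x y₂ * sign x z₂) =
        2 * ∑ v, (if y₂ = y₁ + v then sign u y₁ else 0) *
          (if z₂ = z₁ + v then sign u z₁ else 0) := by decide
  ext ⟨⟨y₁, b₁⟩, ⟨y₂, b₂⟩⟩ ⟨⟨z₁, c₁⟩, ⟨z₂, c₂⟩⟩
  have := congrArg (Int.cast (R := ℂ)) (key u y₁ y₂ z₁ z₂)
  push_cast at this
  rw [Matrix.sum_apply]
  simp only [kroneckerMap_apply, signIncl_mul_conjTranspose_apply, Matrix.smul_apply]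
  simp only [mul_apply, pairSignIncl, conjTranspose_apply, of_apply, Fintype.sum_prod_type]
  by_cases h₁ : b₁ = c₁
  · by_cases h₂ : b₂ = c₂
    · subst h₁ h₂
      simp only [if_true, Complex.real_smul]
      push_cast
      rw [this]
      simp [apply_ite]
    · simp [h₂, apply_ite]
  · simp [h₁, apply_ite]

theorem conjTranspose_pairSignIncl_mul_directSum_mul (M : ZMod 2 → Matrix B₁ B₁ ℂ)
    (N : ZMod 2 → Matrix B₂ B₂ ℂ) (u : ZMod 2) :
    (pairSignIncl B₁ B₂ u)ᴴ * (directSum M ⊗ₖ directSum N) * pairSignIncl B₁ B₂ u =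
      directSum fun v => ∑ x, M (v + x) ⊗ₖ N x := by
  have key : ∀ x y : ZMod 2, sign x y * sign x y = 1 := by decide
  ext ⟨v, ⟨b₁, b₂⟩⟩ ⟨w, ⟨c₁, c₂⟩⟩
  simp only [mul_apply, pairSignIncl, conjTranspose_apply, of_apply, directSum_apply,
    kroneckerMap_apply, Fintype.sum_prod_type]
  simp only [apply_ite star, star_zero, ite_mul, zero_mul, Finset.sum_ite_eq', Finset.mem_univ,
    if_true]
  simp only [mul_ite, mul_zero, Finset.sum_ite_eq', Finset.mem_univ, if_true]
  by_cases h : v = w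
  · subst h
    rw [if_pos rfl, Matrix.sum_apply, ← Equiv.sum_comp (Equiv.addRight v)
      fun x => (M (v + x) ⊗ₖ N x) (b₁, b₂) (c₁, c₂)]
    refine Finset.sum_congr rfl fun y _ => ?_
    have hy : ∀ v y : ZMod 2, v + (y + v) = y := by decide
    have := congrArg (Int.cast (R := ℂ)) (key u y)
    push_cast at this
    simp only [if_true, star_intCast, Equiv.coe_addRight, kroneckerMap_apply, hy]
    linear_combination (M y b₁ c₁ * N (y + v) b₂ c₂) * this
  · simp [h]

end Signs

/-! ### The dual channel -/

section Dual

variable {α : ℝ} (hα : 0 < α) (W W₁ W₂ : CQChannel)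

theorem posSemidef_directSum_sandwich (α : ℝ) (W : CQChannel) :
    (directSum (sandwich α W)).PosSemidef :=
  posSemidef_directSum (posSemidef_sandwich α W)

/-- The dual channel. With `Q` the direct sum of the sandwiched outputs of `W`, `X` the flip of the
label of the summand and `K = Q ^ (α / 2)`, it sends `x` to `K (1 + (-1) ^ x X) K / Tr Q ^ α`, where
`1 + (-1) ^ x X` is written as the product of `signIncl` with its adjoint. -/
def dual {α : ℝ} (hα : 0 < α) (W : CQChannel) : CQChannel where
  Out := ZMod 2 × W.Out
  state x := (renyiTrace α W)⁻¹ •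
    (matPow (directSum (sandwich α W)) (α / 2) *
      (signIncl W.Out x * (signIncl W.Out x)ᴴ) * matPow (directSum (sandwich α W)) (α / 2))
  posSemidef_state x := by
    have h := (posSemidef_self_mul_conjTranspose (signIncl W.Out x)).mul_mul_conjTranspose_same
      (matPow (directSum (sandwich α W)) (α / 2))
    rw [(posSemidef_matPow (posSemidef_directSum_sandwich α W) _).1.eq] at h
    exact h.smul (inv_nonneg.2 (renyiTrace_pos W hα).le)
  trace_state x := by
    have hQ := posSemidef_directSum_sandwich α W
    have hd : matPow (directSum (sandwich α W)) α =
        directSum fun y => matPow (sandwich α W y) α :=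
      cfc_directSum _ fun y => (posSemidef_sandwich α W y).1
    rw [trace_smul, trace_mul_comm, ← mul_assoc,
      matPow_mul_matPow hQ (by rw [add_halves]; exact hα.ne'), add_halves, ← Matrix.mul_assoc,
      trace_mul_comm, ← Matrix.mul_assoc, hd, conjTranspose_signIncl_mul_directSum_mul, trace_sum,
      ← trace_directSum, ← hd, trace_eq_ofReal_re (posSemidef_matPow hQ α), ← renyiTrace,
      Complex.real_smul, ← Complex.ofReal_mul, inv_mul_cancel₀ (renyiTrace_pos W hα).ne',
      Complex.ofReal_one]

/-- The two sign projections sum to the identity, so the flip drops out of the average. -/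
theorem avg_dual : (dual hα W).avg = ((renyiTrace α W)⁻¹ • matPow (directSum (sandwich α W)) α :
    Matrix (ZMod 2 × W.Out) (ZMod 2 × W.Out) ℂ) := by
  have hQ := posSemidef_directSum_sandwich α W
  change ((1 / 2 : ℝ) • ∑ x, (renyiTrace α W)⁻¹ •
    (matPow (directSum (sandwich α W)) (α / 2) *
      (signIncl W.Out x * (signIncl W.Out x)ᴴ) * matPow (directSum (sandwich α W)) (α / 2))) = _
  rw [← Finset.smul_sum, ← Finset.sum_mul, ← Finset.mul_sum, sum_signIncl_mul_conjTranspose,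
    mul_smul_comm, smul_mul_assoc, mul_one,
    matPow_mul_matPow hQ (by rw [add_halves]; exact hα.ne'), add_halves, smul_smul, smul_smul]
  congr 1
  ring

/-- The scalar by which the sandwiched outputs of the dual channel are normalized. -/
def dualScale (α : ℝ) (W : CQChannel) : ℝ := (renyiTrace α W)⁻¹ ^ (1 / α) / 2

theorem dualScale_nonneg {α : ℝ} (hα : 0 < α) (W : CQChannel) : 0 ≤ dualScale α W :=
  div_nonneg (Real.rpow_nonneg (inv_nonneg.2 (renyiTrace_pos W hα).le) _) two_pos.le

theorem sandwich_dual (x : ZMod 2) :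
    sandwich α (dual hα W) x = (dualScale α W •
      (matPow (directSum (sandwich α W)) (1 / 2) *
        (signIncl W.Out x * (signIncl W.Out x)ᴴ) *
        matPow (directSum (sandwich α W)) (1 / 2)) :
      Matrix (ZMod 2 × W.Out) (ZMod 2 × W.Out) ℂ) := by
  have hQ := posSemidef_directSum_sandwich α W
  have hg : 0 < (renyiTrace α W)⁻¹ := inv_pos.2 (renyiTrace_pos W hα)
  have hs : α * ((1 - α) / (2 * α)) + α / 2 = 1 / 2 := by field_simp; ring
  have hs' : α / 2 + α * ((1 - α) / (2 * α)) = 1 / 2 := by rw [add_comm, hs]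
  have hscale : (renyiTrace α W)⁻¹ ^ ((1 - α) / (2 * α)) * (1 / 2 * (renyiTrace α W)⁻¹ *
      (renyiTrace α W)⁻¹ ^ ((1 - α) / (2 * α))) = dualScale α W := by
    have h : 1 / α = (1 - α) / (2 * α) + (1 - α) / (2 * α) + 1 := by field_simp; ring
    rw [dualScale, h, Real.rpow_add hg, Real.rpow_add hg, Real.rpow_one]
    ring
  -- `(dual hα W).Out` is unfolded to `ZMod 2 × W.Out` by quantifying over matrices on the latter.
  have key : ∀ ρ : Matrix (ZMod 2 × W.Out) (ZMod 2 × W.Out) ℂ,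
      ρ = (renyiTrace α W)⁻¹ • matPow (directSum (sandwich α W)) α →
      matPow ρ ((1 - α) / (2 * α)) * ((1 / 2 : ℝ) • (renyiTrace α W)⁻¹ •
        (matPow (directSum (sandwich α W)) (α / 2) *
          (signIncl W.Out x * (signIncl W.Out x)ᴴ) * matPow (directSum (sandwich α W)) (α / 2))) *
        matPow ρ ((1 - α) / (2 * α)) = dualScale α W •
      (matPow (directSum (sandwich α W)) (1 / 2) *
        (signIncl W.Out x * (signIncl W.Out x)ᴴ) *
        matPow (directSum (sandwich α W)) (1 / 2)) := by
    rintro _ rfl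
    rw [matPow_smul (posSemidef_matPow hQ _) hg.le, matPow_matPow hQ]
    simp only [smul_mul_assoc, mul_smul_comm, smul_smul]
    rw [hscale]
    congr 1
    calc _ = (matPow (directSum (sandwich α W)) (α * ((1 - α) / (2 * α))) *
          matPow (directSum (sandwich α W)) (α / 2)) *
          (signIncl W.Out x * (signIncl W.Out x)ᴴ) *
          (matPow (directSum (sandwich α W)) (α / 2) *
          matPow (directSum (sandwich α W)) (α * ((1 - α) / (2 * α)))) := by
          simp only [mul_assoc]
      _ = _ := by
          rw [matPow_mul_matPow hQ (by rw [hs]; norm_num),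
            matPow_mul_matPow hQ (by rw [hs']; norm_num), hs, hs']
  exact key _ (avg_dual hα W)

/-- The sandwiched outputs of the dual channel have, up to scale, the nonzero spectrum of
`ρ ^ (1 / α)`, where `ρ` is the average output of the channel. -/
theorem trace_cfc_sandwich_dual {f : ℝ → ℝ} (hf : f 0 = 0) (x : ZMod 2) :
    (cfc f (sandwich α (dual hα W) x)).trace =
      (cfc f (dualScale α W • matPow W.avg (1 / α))).trace := by
  have hQ := posSemidef_directSum_sandwich α W
  have h := trace_cfc_smul_mul_conjTranspose_comm hf (dualScale_nonneg hα W)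
    (matPow (directSum (sandwich α W)) (1 / 2) * signIncl W.Out x)
  rw [conjTranspose_mul, (posSemidef_matPow hQ _).1.eq] at h
  have h₁ : (signIncl W.Out x)ᴴ * matPow (directSum (sandwich α W)) (1 / 2) *
      (matPow (directSum (sandwich α W)) (1 / 2) * signIncl W.Out x) = matPow W.avg (1 / α) := by
    rw [← sum_sandwich W hα, ← conjTranspose_signIncl_mul_directSum_mul (sandwich α W) x]
    conv_rhs => rw [← matPow_one hQ, ← add_halves (1 : ℝ), ← matPow_mul_matPow hQ (by norm_num)]
    simp only [Matrix.mul_assoc]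
  rw [h₁] at h
  rw [← h, sandwich_dual]
  simp only [Matrix.mul_assoc]
  rfl

/-- The sandwiched outputs of the combination of two dual channels each have, up to scale, the
nonzero spectrum of the direct sum of the sandwiched outputs of the combination of the original
channels. -/
theorem trace_cfc_sandwich_boxPlus_dual {f : ℝ → ℝ} (hf : f 0 = 0) (u : ZMod 2) :
    (cfc f (sandwich α (boxPlus (dual hα W₁) (dual hα W₂)) u)).trace =
      (cfc f ((2 * dualScale α W₁ * dualScale α W₂) •
        directSum (sandwich α (boxPlus W₁ W₂)))).trace := by
  have hQ₁ := posSemidef_directSum_sandwich α W₁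
  have hQ₂ := posSemidef_directSum_sandwich α W₂
  have hc : 0 ≤ 2 * dualScale α W₁ * dualScale α W₂ :=
    mul_nonneg (mul_nonneg two_pos.le (dualScale_nonneg hα W₁)) (dualScale_nonneg hα W₂)
  set S₁ := matPow (directSum (sandwich α W₁)) (1 / 2) with hS₁
  set S₂ := matPow (directSum (sandwich α W₂)) (1 / 2) with hS₂
  have hS₁S₁ : S₁ * S₁ = directSum (sandwich α W₁) := by
    rw [hS₁, matPow_mul_matPow hQ₁ (by norm_num), add_halves, matPow_one hQ₁]
  have hS₂S₂ : S₂ * S₂ = directSum (sandwich α W₂) := by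
    rw [hS₂, matPow_mul_matPow hQ₂ (by norm_num), add_halves, matPow_one hQ₂]
  have hS : (S₁ ⊗ₖ S₂)ᴴ = S₁ ⊗ₖ S₂ := by
    rw [conjTranspose_kronecker, (posSemidef_matPow hQ₁ _).1.eq, (posSemidef_matPow hQ₂ _).1.eq]
  have h := trace_cfc_smul_mul_conjTranspose_comm hf hc
    ((S₁ ⊗ₖ S₂) * pairSignIncl W₁.Out W₂.Out u)
  have hleft : ∑ x, sandwich α (dual hα W₁) (u + x) ⊗ₖ sandwich α (dual hα W₂) x =
      (2 * dualScale α W₁ * dualScale α W₂) •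
        ((S₁ ⊗ₖ S₂) * pairSignIncl W₁.Out W₂.Out u *
          ((S₁ ⊗ₖ S₂) * pairSignIncl W₁.Out W₂.Out u)ᴴ) := by
    have h₁ : ∑ x, sandwich α (dual hα W₁) (u + x) ⊗ₖ sandwich α (dual hα W₂) x =
        ∑ x, (dualScale α W₁ * dualScale α W₂) • ((S₁ ⊗ₖ S₂) *
          ((signIncl W₁.Out (u + x) * (signIncl W₁.Out (u + x))ᴴ) ⊗ₖ
            (signIncl W₂.Out x * (signIncl W₂.Out x)ᴴ)) * (S₁ ⊗ₖ S₂)) := by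
      refine Finset.sum_congr rfl fun x _ => ?_
      rw [sandwich_dual, sandwich_dual, ← mul_kronecker_mul, ← mul_kronecker_mul]
      exact (smul_kronecker _ _ _).trans
        ((congrArg _ (kronecker_smul _ _ _)).trans (smul_smul _ _ _))
    refine h₁.trans ?_
    rw [← Finset.smul_sum, ← Finset.sum_mul, ← Finset.mul_sum, sum_signIncl_kronecker,
      mul_smul_comm, smul_mul_assoc, smul_smul, mul_comm _ (2 : ℝ), ← mul_assoc (2 : ℝ)]
    simp only [conjTranspose_mul, hS, Matrix.mul_assoc]
    rfl
  have hright : ((S₁ ⊗ₖ S₂) * pairSignIncl W₁.Out W₂.Out u)ᴴ *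
      ((S₁ ⊗ₖ S₂) * pairSignIncl W₁.Out W₂.Out u) =
      directSum (sandwich α (boxPlus W₁ W₂)) := by
    rw [conjTranspose_mul, hS]
    calc _ = (pairSignIncl W₁.Out W₂.Out u)ᴴ * ((S₁ ⊗ₖ S₂) * (S₁ ⊗ₖ S₂)) *
          pairSignIncl W₁.Out W₂.Out u := by simp only [Matrix.mul_assoc]
      _ = _ := by
          rw [← mul_kronecker_mul, hS₁S₁, hS₂S₂, conjTranspose_pairSignIncl_mul_directSum_mul]
          exact congrArg directSum (funext fun v => (sandwich_boxPlus W₁ W₂ v).symm)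
  rw [hright, ← hleft] at h
  rw [sandwich_boxPlus]
  exact h

/-! ### Entropies of the dual channels -/

theorem inv_mul_log_two_mul_div (h1 : α ≠ 1) {g : ℝ} (hg : 0 < g) :
    1 / (1 - α) * Real.log (2 * (g / 2 ^ α)) = Real.log 2 + 1 / (1 - α) * Real.log g := by
  have h : (1 - α) ≠ 0 := sub_ne_zero.2 (Ne.symm h1)
  rw [Real.log_mul two_ne_zero (by positivity), Real.log_div hg.ne' (by positivity),
    Real.log_rpow two_pos]
  field_simp
  ring

theorem dualScale_rpow {α : ℝ} (hα : 0 < α) (W : CQChannel) :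
    dualScale α W ^ α = (renyiTrace α W)⁻¹ / 2 ^ α := by
  have hg : 0 ≤ (renyiTrace α W)⁻¹ := inv_nonneg.2 (renyiTrace_pos W hα).le
  rw [dualScale, Real.div_rpow (Real.rpow_nonneg hg _) two_pos.le, ← Real.rpow_mul hg,
    one_div_mul_cancel hα.ne', Real.rpow_one]

theorem renyiTrace_dual : renyiTrace α (dual hα W) = 2 * ((renyiTrace α W)⁻¹ / 2 ^ α) := by
  have h0 : (fun t : ℝ => t ^ α) 0 = 0 := Real.zero_rpow hα.ne'
  have hsum : ∀ x, (matPow (sandwich α (dual hα W) x) α).trace.re =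
      (renyiTrace α W)⁻¹ / 2 ^ α := by
    intro x
    have h := trace_cfc_sandwich_dual hα W (f := fun t => t ^ α) h0 x
    rw [matPow, h]
    change (matPow (dualScale α W • matPow W.avg (1 / α)) α).trace.re = _
    rw [matPow_smul (posSemidef_matPow W.posSemidef_avg _) (dualScale_nonneg hα W),
      matPow_matPow W.posSemidef_avg, one_div_mul_cancel hα.ne', matPow_one W.posSemidef_avg,
      trace_smul, trace_avg, dualScale_rpow hα]
    simp
  rw [renyiTrace_eq_sum, Finset.sum_congr rfl fun x _ => hsum x, sum_zmod_two, two_mul]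

theorem renyiTrace_boxPlus_dual : renyiTrace α (boxPlus (dual hα W₁) (dual hα W₂)) =
    2 * (renyiTrace α (boxPlus W₁ W₂) / (renyiTrace α W₁ * renyiTrace α W₂) / 2 ^ α) := by
  have h0 : (fun t : ℝ => t ^ α) 0 = 0 := Real.zero_rpow hα.ne'
  have hsum : ∀ u, (matPow (sandwich α (boxPlus (dual hα W₁) (dual hα W₂)) u) α).trace.re =
      renyiTrace α (boxPlus W₁ W₂) / (renyiTrace α W₁ * renyiTrace α W₂) / 2 ^ α := by
    intro u
    have h := trace_cfc_sandwich_boxPlus_dual hα W₁ W₂ (f := fun t => t ^ α) h0 u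
    have hc : 0 ≤ 2 * dualScale α W₁ :=
      mul_nonneg two_pos.le (dualScale_nonneg hα W₁)
    rw [matPow, h]
    change (matPow ((2 * dualScale α W₁ * dualScale α W₂) •
        directSum (sandwich α (boxPlus W₁ W₂))) α).trace.re = _
    rw [matPow_smul (posSemidef_directSum_sandwich _ _)
      (mul_nonneg hc (dualScale_nonneg hα W₂)), trace_smul, Complex.smul_re, ← renyiTrace,
      Real.mul_rpow hc (dualScale_nonneg hα W₂),
      Real.mul_rpow two_pos.le (dualScale_nonneg hα W₁), dualScale_rpow hα, dualScale_rpow hα,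
      smul_eq_mul]
    have := renyiTrace_pos W₁ hα
    have := renyiTrace_pos W₂ hα
    have : (0 : ℝ) < 2 ^ α := by positivity
    field_simp
  rw [renyiTrace_eq_sum, Finset.sum_congr rfl fun x _ => hsum x, sum_zmod_two, two_mul]

theorem dualScale_one : dualScale 1 W = 1 / 2 := by
  simp [dualScale, renyiTrace_one]

theorem vonNeumann_avg_dual_one (h : (0 : ℝ) < 1) :
    vonNeumann (dual h W).avg = vonNeumann (directSum (sandwich 1 W)) := by
  have h' : (renyiTrace 1 W)⁻¹ • matPow (directSum (sandwich 1 W)) 1 =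
      directSum (sandwich 1 W) := by
    rw [renyiTrace_one, inv_one, one_smul, matPow_one (posSemidef_directSum_sandwich 1 W)]
  exact congrArg vonNeumann ((avg_dual h W).trans h')

theorem vonNeumann_half {n : Type*} [Fintype n] [DecidableEq n] {M : Matrix n n ℂ}
    (hM : M.PosSemidef) (ht : M.trace.re = 1) :
    vonNeumann ((1 / 2 : ℝ) • M) + vonNeumann ((1 / 2 : ℝ) • M) = vonNeumann M + Real.log 2 := by
  rw [vonNeumann_smul hM, ht, Real.negMulLog, one_div, Real.log_inv]
  ring

theorem trace_directSum_sandwich_one : (directSum (sandwich 1 W)).trace.re = 1 := by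
  have h := renyiTrace_one W
  rwa [renyiTrace, matPow_one (posSemidef_directSum_sandwich 1 W)] at h

theorem H_dual : H α (dual hα W) = Real.log 2 - H α W := by
  by_cases h1 : α = 1
  · subst h1
    have hx : ∀ x, vonNeumann (sandwich 1 (dual hα W) x) = vonNeumann ((1 / 2 : ℝ) • W.avg) := by
      intro x
      have h := trace_cfc_sandwich_dual hα W Real.negMulLog_zero x
      rw [dualScale_one, div_one, matPow_one W.posSemidef_avg] at h
      rw [vonNeumann, h, vonNeumann]
    rw [H_one, H_one, vonNeumann_directSum fun x => (posSemidef_sandwich _ _ x).1,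
      Finset.sum_congr rfl fun x _ => hx x, sum_zmod_two,
      vonNeumann_half W.posSemidef_avg (by simp [trace_avg]), vonNeumann_avg_dual_one]
    ring
  · rw [H_of_ne_one _ h1, H_of_ne_one _ h1, renyiTrace_dual hα,
      inv_mul_log_two_mul_div h1 (inv_pos.2 (renyiTrace_pos W hα)), Real.log_inv]
    ring

/-- Duality turns the combination into itself up to an additive constant: the simultaneous flip
`X ⊗ X` preserves the parity of the two labels, and the parity sectors of `Q₁ ⊗ Q₂` are the
sandwiched outputs of the combined channel. -/
theorem H_boxPlus_dual : H α (boxPlus (dual hα W₁) (dual hα W₂)) =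
    Real.log 2 + H α (boxPlus W₁ W₂) - H α W₁ - H α W₂ := by
  by_cases h1 : α = 1
  · subst h1
    have hQ₁ := posSemidef_directSum_sandwich 1 W₁
    have hQ₂ := posSemidef_directSum_sandwich 1 W₂
    have hu : ∀ u, vonNeumann (sandwich 1 (boxPlus (dual hα W₁) (dual hα W₂)) u) =
        vonNeumann ((1 / 2 : ℝ) • directSum (sandwich 1 (boxPlus W₁ W₂))) := by
      intro u
      have h := trace_cfc_sandwich_boxPlus_dual hα W₁ W₂ Real.negMulLog_zero u
      rw [dualScale_one, dualScale_one, mul_one_div_cancel two_ne_zero, one_mul] at h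
      rw [vonNeumann, h, vonNeumann]
    have hprod : ∀ V₁ V₂ : CQChannel, vonNeumann (boxPlus V₁ V₂).avg =
        vonNeumann V₁.avg + vonNeumann V₂.avg := by
      intro V₁ V₂
      have h := vonNeumann_kronecker V₁.posSemidef_avg V₂.posSemidef_avg
      rw [trace_avg, trace_avg, Complex.one_re, one_mul, one_mul, add_comm] at h
      rw [← h]
      exact congrArg vonNeumann (avg_boxPlus V₁ V₂)
    rw [H_one, H_one, H_one, H_one, vonNeumann_directSum fun x => (posSemidef_sandwich _ _ x).1,
      Finset.sum_congr rfl fun x _ => hu x, sum_zmod_two,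
      vonNeumann_half (posSemidef_directSum_sandwich _ _) (trace_directSum_sandwich_one _),
      hprod, hprod, vonNeumann_avg_dual_one, vonNeumann_avg_dual_one]
    ring
  · have hg₁ := renyiTrace_pos W₁ hα
    have hg₂ := renyiTrace_pos W₂ hα
    have hg := renyiTrace_pos (boxPlus W₁ W₂) hα
    rw [H_of_ne_one _ h1, H_of_ne_one _ h1, H_of_ne_one _ h1, H_of_ne_one _ h1,
      renyiTrace_boxPlus_dual hα, inv_mul_log_two_mul_div h1 (by positivity),
      Real.log_div hg.ne' (by positivity), Real.log_mul hg₁.ne' hg₂.ne']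
    ring

end Dual

end CQChannel

/-! ### Symmetry of optimal bounds -/

section Symmetry

variable {α : ℝ}

open CQChannel

/-- The reflection `f (log 2 - h₁, log 2 - h₂) + h₁ + h₂ - log 2` of a bound `f`. -/
def reflect (f : ℝ → ℝ → ℝ) (h₁ h₂ : ℝ) : ℝ :=
  f (Real.log 2 - h₁) (Real.log 2 - h₂) + h₁ + h₂ - Real.log 2

theorem IsLowerBound.reflect (hα : 0 < α) {f : ℝ → ℝ → ℝ} (hf : IsLowerBound α f) :
    IsLowerBound α (reflect f) := fun W₁ W₂ => by
  have h := hf (dual hα W₁) (dual hα W₂)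
  rw [H_dual, H_dual, H_boxPlus_dual] at h
  rw [RenyiCombining.reflect]
  linarith

theorem IsUpperBound.reflect (hα : 0 < α) {f : ℝ → ℝ → ℝ} (hf : IsUpperBound α f) :
    IsUpperBound α (reflect f) := fun W₁ W₂ => by
  have h := hf (dual hα W₁) (dual hα W₂)
  rw [H_dual, H_dual, H_boxPlus_dual] at h
  rw [RenyiCombining.reflect]
  linarith

/-- Optimality against the reflected bound gives one inequality between the two sides; the same at
the dual channels gives the other. -/
theorem IsOptimalLowerBound.isSymmetricBound (hα : 0 < α) {L : ℝ → ℝ → ℝ}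
    (hL : IsOptimalLowerBound α L) : IsSymmetricBound α L := fun W₁ W₂ => by
  have h := hL.2 _ (hL.1.reflect hα) W₁ W₂
  have h' := hL.2 _ (hL.1.reflect hα) (dual hα W₁) (dual hα W₂)
  simp only [H_dual, reflect, sub_sub_cancel] at h h'
  linarith

theorem IsOptimalUpperBound.isSymmetricBound (hα : 0 < α) {U : ℝ → ℝ → ℝ}
    (hU : IsOptimalUpperBound α U) : IsSymmetricBound α U := fun W₁ W₂ => by
  have h := hU.2 _ (hU.1.reflect hα) W₁ W₂
  have h' := hU.2 _ (hU.1.reflect hα) (dual hα W₁) (dual hα W₂)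
  simp only [H_dual, reflect, sub_sub_cancel] at h h'
  linarith

end Symmetry

end RenyiCombining

end

open RenyiCombining RenyiCombining.CQChannel in
theorem mainTheorem7 (α : ℝ) (hα : 0 < α) :
    (∀ W₁ W₂ : CQChannel, ∃ V₁ V₂ : CQChannel,
      H α V₁ = Real.log 2 - H α W₁ ∧
      H α V₂ = Real.log 2 - H α W₂ ∧
      H α (boxPlus W₁ W₂) - (1 / 2) * (H α W₁ + H α W₂) =
        H α (boxPlus V₁ V₂) - (1 / 2) * (H α V₁ + H α V₂)) ∧
    (∀ L : ℝ → ℝ → ℝ, IsOptimalLowerBound α L → IsSymmetricBound α L) ∧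
    (∀ U : ℝ → ℝ → ℝ, IsOptimalUpperBound α U → IsSymmetricBound α U) := by
  refine ⟨fun W₁ W₂ => ⟨dual hα W₁, dual hα W₂, H_dual hα W₁, H_dual hα W₂, ?_⟩,
    fun L hL => hL.isSymmetricBound hα, fun U hU => hU.isSymmetricBound hα⟩
  rw [H_boxPlus_dual, H_dual, H_dual]
  ring
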